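/- Let $f(n)>1$ $(n\ge 2)$ be an increasing (not necessarily strictly) and unbounded real-valued function of the integer $n$. Then there exist infinitely many Borel probability measures $\mu$ on $[0,1)$ such that: (i) for every integer $n\ge 2$, $\mu$ is $n$-adic doubling with constant at most $f(n)$, that is, $\mu(J_1)\le f(n)\,\mu(J_2)$ for all $n$-adic siblings $J_1,J_2\subseteq[0,1)$; and (ii) $\mu$ is not doubling, that is, there is no constant $C>0$ such that $\mu(I_1)\le C\,\mu(I_2)$ for all adjacent intervals $I_1,I_2\subseteq[0,1)$ of equal length. Here intervals are bounded and of the form $[x,y)$ with $x<y$. The $n$-adic intervals are the intervals $\left[\frac{k-1}{n^m},\frac{k}{n^m}\right)$ with $m,k\in\mathbb Z$. The children of such an interval are the $n$ intervals $\left[\frac{k-1}{n^m}+\frac{j-1}{n^{m+1}},\frac{k-1}{n^m}+\frac{j}{n^{m+1}}\right)$, $1\le j\le n$, and $n$-adic siblings are children of a common $n$-adic interval. -/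

import Mathlib

open MeasureTheory Set

/-- The `j`-th child (`1 ≤ j ≤ n`) of the `n`-adic interval `[(k - 1) / n ^ m, k / n ^ m)`,
where `m` and `k` are integers. -/
def nAdicChild (n : ℕ) (m k : ℤ) (j : ℕ) : Set ℝ :=
  Ico (((k : ℝ) - 1) / (n : ℝ) ^ m + ((j : ℝ) - 1) / (n : ℝ) ^ (m + 1))
    (((k : ℝ) - 1) / (n : ℝ) ^ m + (j : ℝ) / (n : ℝ) ^ (m + 1))

/-- `J₁` and `J₂` are `n`-adic siblings: children of a common `n`-adic interval. -/
def IsNAdicSiblings (n : ℕ) (J₁ J₂ : Set ℝ) : Prop :=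
  ∃ m k : ℤ, ∃ i ∈ Icc 1 n, ∃ j ∈ Icc 1 n,
    J₁ = nAdicChild n m k i ∧ J₂ = nAdicChild n m k j

/-- The measure `μ`, with domain `S ⊆ ℝ`, is `n`-adic doubling with constant `C`. Only intervals
that lie in the domain are considered. -/
def IsNAdicDoublingWith (S : Set ℝ) (n : ℕ) (C : ℝ) (μ : Measure ℝ) : Prop :=
  ∀ J₁ J₂ : Set ℝ, IsNAdicSiblings n J₁ J₂ → J₁ ⊆ S → J₂ ⊆ S →
    μ J₁ ≤ ENNReal.ofReal C * μ J₂

/-- The measure `μ`, with domain `S ⊆ ℝ`, is doubling: one constant bounds, in both directions,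
the measures of any two adjacent intervals `[x, x + h)` and `[x + h, x + 2 h)` of equal length
that lie in the domain. -/
def IsDoublingOn (S : Set ℝ) (μ : Measure ℝ) : Prop :=
  ∃ C : ℝ, 0 < C ∧ ∀ x h : ℝ, 0 < h → Ico x (x + h) ⊆ S → Ico (x + h) (x + 2 * h) ⊆ S →
    μ (Ico x (x + h)) ≤ ENNReal.ofReal C * μ (Ico (x + h) (x + 2 * h)) ∧
    μ (Ico (x + h) (x + 2 * h)) ≤ ENNReal.ofReal C * μ (Ico x (x + h))

/-! Doubling is made to fail at points x where the density is tall just to the left and equal to 1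
to the right. The bump on the left is ε times a tent in log (x - y), living at distances between η
and H from x. Its height T may be large, yet at distances in ratio at most n it varies by at most ε
log n.

Suppose some n⁻ᵖ lies within η of x. Siblings whose parent has length at most n⁻ᵖ lie on one side of
n⁻ᵖ, at distances from it in ratio at most n, so their masses nearly agree. Coarser siblings are so
long that the mass T H of the bump is negligible (`isNAdicDoublingWith_bumpDensity`).

Recurrence of a torus rotation puts x = 4⁻q close to a power of every n < N at once
(`frequently_exists_zpow_near`). For n ≥ N the crude bound 1 + T ≤ f n is enough, since f is
unbounded. Bumps of height 4ᵏ at separated points, summed with weights 2⁻ᵏ, give one measure; mixing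
it with Lebesgue measure gives infinitely many. -/

/-! ### Simultaneous approximation by powers. -/

open Filter Topology in
/-- Simultaneous approximation: infinitely many powers of `1 / 4` are relatively close to
a power of every integer `n` with `2 ≤ n < N`. -/
lemma frequently_exists_zpow_near (N : ℕ) {δ : ℝ} (hδ : 0 < δ) (hδ1 : δ ≤ 1) :
    ∃ᶠ q : ℕ in atTop, ∀ n : ℕ, 2 ≤ n → n < N →
      ∃ p : ℤ, |((n : ℝ) ^ p)⁻¹ - ((4 : ℝ) ^ q)⁻¹| ≤ δ * ((4 : ℝ) ^ q)⁻¹ := by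
  let z : Fin N → UnitAddCircle := fun n => ((Real.log 4 / Real.log n : ℝ) : UnitAddCircle)
  -- The radius stays below δ / 2 after multiplication by log n; the added 1 covers the indices 0
  -- and 1, where the logarithm is 0.
  have hr : ∀ n : ℕ, 0 < δ / (2 * (1 + Real.log n)) := fun n => by
    have := Real.log_natCast_nonneg n
    positivity
  have hev : ∀ᶠ y in 𝓝 (0 : Fin N → UnitAddCircle),
      ∀ i : Fin N, ‖y i‖ < δ / (2 * (1 + Real.log (i : ℕ))) := by
    rw [eventually_all]
    intro i
    have hc : ContinuousAt (fun y : Fin N → UnitAddCircle => ‖y i‖) 0 :=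
      (continuous_apply i).norm.continuousAt
    exact hc.eventually_lt_const (by simpa using hr i)
  refine ((mapClusterPt_zero_atTop_nsmul z).frequently hev).mono fun q hq n hn hnN => ?_
  have hlog : 0 < Real.log n := Real.log_pos (by exact_mod_cast hn)
  have h1 := hq ⟨n, hnN⟩
  have h2 : (q • z) ⟨n, hnN⟩ = ((q * (Real.log 4 / Real.log n) : ℝ) : UnitAddCircle) := by
    simp only [z, Pi.smul_apply]
    rw [← nsmul_eq_mul]; rfl
  rw [h2, UnitAddCircle.norm_eq] at h1
  set p : ℤ := round (q * (Real.log 4 / Real.log n))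
  refine ⟨p, ?_⟩
  have hs : |q * Real.log 4 - p * Real.log n| ≤ δ / 2 := by
    have : q * Real.log 4 - p * Real.log n
        = (q * (Real.log 4 / Real.log n) - p) * Real.log n := by field_simp
    rw [this, abs_mul, abs_of_pos hlog]
    calc _ ≤ δ / (2 * (1 + Real.log n)) * Real.log n :=
          mul_le_mul_of_nonneg_right h1.le hlog.le
      _ = δ / 2 * (Real.log n / (1 + Real.log n)) := by field_simp
      _ ≤ δ / 2 * 1 := by
          gcongr
          rw [div_le_one (by positivity)]; linarith
      _ = δ / 2 := by ring
  have h4 : ((4 : ℝ) ^ q) = Real.exp (q * Real.log 4) := by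
    rw [mul_comm, Real.exp_mul, Real.exp_log (by norm_num), Real.rpow_natCast]
  have hnp : ((n : ℝ) ^ p) = Real.exp (p * Real.log n) := by
    rw [mul_comm, Real.exp_mul, Real.exp_log (by positivity), Real.rpow_intCast]
  have hx : (0 : ℝ) < ((4 : ℝ) ^ q)⁻¹ := by positivity
  have hfac : ((n : ℝ) ^ p)⁻¹ - ((4 : ℝ) ^ q)⁻¹
      = (Real.exp (q * Real.log 4 - p * Real.log n) - 1) * ((4 : ℝ) ^ q)⁻¹ := by
    rw [Real.exp_sub, ← h4, ← hnp]
    field_simp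
  rw [hfac, abs_mul, abs_of_pos hx]
  gcongr
  refine (Real.abs_exp_sub_one_le (hs.trans (by linarith))).trans (by linarith)

/-! ### The logarithmic tent. -/

/-- A tent in the logarithmic scale, supported in `[η, H]`. -/
noncomputable def logTent (η H d : ℝ) : ℝ :=
  max 0 (min (Real.log (max d η) - Real.log η) (Real.log H - Real.log (max d η)))

section logTent

variable {η H : ℝ}

lemma logTent_nonneg (η H d : ℝ) : 0 ≤ logTent η H d := le_max_left _ _

lemma logTent_of_le {d : ℝ} (hd : d ≤ η) : logTent η H d = 0 := by
  simp [logTent, max_eq_right hd]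

lemma logTent_of_ge {d : ℝ} (hH : 0 < H) (hd : H ≤ d) : logTent η H d = 0 := by
  refine max_eq_left ((min_le_right _ _).trans ?_)
  exact sub_nonpos.2 (Real.log_le_log hH (hd.trans (le_max_left _ _)))

lemma logTent_le (hη : 0 < η) (hH : η ≤ H) (d : ℝ) :
    logTent η H d ≤ (Real.log H - Real.log η) / 2 := by
  have := Real.log_le_log hη hH
  refine max_le (by linarith) ?_
  rcases le_total (Real.log (max d η) - Real.log η) (Real.log H - Real.log (max d η)) with h | h
  · rw [min_eq_left h]; linarith
  · rw [min_eq_right h]; linarith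

lemma continuous_logTent (hη : 0 < η) : Continuous (logTent η H) := by
  have h : Continuous fun d => Real.log (max d η) :=
    Continuous.log (by fun_prop) fun d => (hη.trans_le (le_max_right _ _)).ne'
  unfold logTent
  fun_prop

lemma abs_logTent_sub_le (hη : 0 < η) {κ c d : ℝ} (h1 : max c η ≤ κ * max d η)
    (h2 : max d η ≤ κ * max c η) : |logTent η H c - logTent η H d| ≤ Real.log κ := by
  have hc : 0 < max c η := hη.trans_le (le_max_right _ _)
  have hd : 0 < max d η := hη.trans_le (le_max_right _ _)
  have hκ : 0 < κ := by
    by_contra! h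
    nlinarith
  have l1 := Real.log_le_log hc h1
  have l2 := Real.log_le_log hd h2
  rw [Real.log_mul hκ.ne' hd.ne'] at l1
  rw [Real.log_mul hκ.ne' hc.ne'] at l2
  unfold logTent
  refine (abs_max_sub_max_le_max _ _ _ _).trans (max_le (by simp; linarith) ?_)
  refine (abs_min_sub_min_le_max _ _ _ _).trans (max_le ?_ ?_) <;> rw [abs_le] <;>
    constructor <;> linarith

lemma abs_logTent_sub_le_of_ratio (hη : 0 < η) {κ c d : ℝ} (hκ : 1 ≤ κ) (h1 : c ≤ κ * d)
    (h2 : d ≤ κ * c) : |logTent η H c - logTent η H d| ≤ Real.log κ := by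
  have hκ0 : 0 ≤ κ := zero_le_one.trans hκ
  apply abs_logTent_sub_le hη
  · exact max_le (h1.trans (by gcongr; exact le_max_left _ _))
      ((le_max_right d η).trans (le_mul_of_one_le_left (hη.le.trans (le_max_right _ _)) hκ))
  · exact max_le (h2.trans (by gcongr; exact le_max_left _ _))
      ((le_max_right c η).trans (le_mul_of_one_le_left (hη.le.trans (le_max_right _ _)) hκ))

/-- Truncation at η makes the tent insensitive to shifts by at most η: they change `max u η` by a
factor of at most 2. This absorbs the error in n⁻ᵖ ≈ x. -/
lemma abs_logTent_add_sub_le (hη : 0 < η) {e u : ℝ} (he : |e| ≤ η) :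
    |logTent η H (u + e) - logTent η H u| ≤ Real.log 2 := by
  rw [abs_le] at he
  have h1 := le_max_left u η
  have h2 := le_max_right u η
  have h3 := le_max_left (u + e) η
  have h4 := le_max_right (u + e) η
  exact abs_logTent_sub_le hη (max_le (by linarith) (by linarith))
    (max_le (by linarith) (by linarith))

end logTent

/-! ### The bump density and its means. -/

/-- The density `1 + ε * tent`, the tent being placed to the left of `x`. -/
noncomputable def bumpDensity (ε η H x y : ℝ) : ℝ := 1 + ε * logTent η H (x - y)

section bumpDensity

variable {ε η H x : ℝ}

lemma continuous_bumpDensity (hη : 0 < η) : Continuous (bumpDensity ε η H x) := by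
  have := (continuous_logTent (H := H) hη).comp
    (continuous_const.sub continuous_id : Continuous fun y : ℝ => x - y)
  exact continuous_const.add (continuous_const.mul this)

lemma one_le_bumpDensity (hε : 0 ≤ ε) (y : ℝ) : 1 ≤ bumpDensity ε η H x y :=
  le_add_of_nonneg_right (mul_nonneg hε (logTent_nonneg _ _ _))

lemma integral_log_sub_log_le {a c : ℝ} (ha : 0 ≤ a) (hac : a < c) :
    ∫ u in a..c, (Real.log c - Real.log u) ≤ c - a := by
  rw [intervalIntegral.integral_sub (by simp) intervalIntegral.intervalIntegrable_log',
    integral_log, intervalIntegral.integral_const, smul_eq_mul]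
  have : 0 ≤ a * (Real.log c - Real.log a) := by
    rcases ha.eq_or_lt with rfl | ha
    · simp
    · exact mul_nonneg ha.le (sub_nonneg.2 (Real.log_le_log ha hac.le))
  linarith

/-- The mean of the bump density over `[b - c, b - a]` is close to `1 + ε * logTent η H c`,
for every base point `b` near `x`. -/
lemma abs_integral_bumpDensity_sub_le (hε : 0 ≤ ε) (hη : 0 < η) {a b c : ℝ} (ha : 0 ≤ a)
    (hac : a < c) (hb : |b - x| ≤ η) :
    |(∫ y in (b - c)..(b - a), bumpDensity ε η H x y) - (c - a) * (1 + ε * logTent η H c)|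
      ≤ 2 * ε * (c - a) := by
  have hcont := continuous_bumpDensity (ε := ε) (H := H) (x := x) hη
  have hcont' : Continuous fun u => bumpDensity ε η H x (b - u) := by fun_prop
  rw [← intervalIntegral.integral_comp_sub_left (fun y => bumpDensity ε η H x y) b]
  have hconst : (c - a) * (1 + ε * logTent η H c) = ∫ _ in a..c, (1 + ε * logTent η H c) := by
    rw [intervalIntegral.integral_const, smul_eq_mul]
  rw [hconst, ← intervalIntegral.integral_sub (hcont'.intervalIntegrable _ _) (by simp),
    ← Real.norm_eq_abs]
  have hint : IntervalIntegrable (fun u => Real.log c - Real.log u) volume a c :=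
    IntervalIntegrable.sub (by simp) intervalIntegral.intervalIntegrable_log'
  have hint2 : IntervalIntegrable (fun u => ε * (1 + (Real.log c - Real.log u))) volume a c :=
    (IntervalIntegrable.add (by simp) hint).const_mul ε
  refine (intervalIntegral.norm_integral_le_of_norm_le hac.le
    (g := fun u => ε * (1 + (Real.log c - Real.log u))) (.of_forall fun u hu => ?_) hint2).trans ?_
  · have hu0 : 0 < u := ha.trans_lt hu.1
    -- Moving the base point from b to x costs log 2 ≤ 1, and replacing u by c costs log (c / u),
    -- whose mean over [a, c] is at most 1; hence the factor 2.
    have e1 := abs_logTent_add_sub_le (H := H) hη (e := x - b) (u := u) (by rwa [abs_sub_comm])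
    have e2 := abs_logTent_sub_le_of_ratio (H := H) hη (κ := c / u) (c := u) (d := c)
      ((one_le_div hu0).2 hu.2)
      (hu.2.trans (le_mul_of_one_le_left (hu0.le.trans hu.2) ((one_le_div hu0).2 hu.2)))
      (by field_simp; rfl)
    rw [Real.log_div (hu0.trans_le hu.2).ne' hu0.ne'] at e2
    have e3 : Real.log 2 ≤ 1 := by linarith [Real.log_two_lt_d9]
    have e4 : bumpDensity ε η H x (b - u) - (1 + ε * logTent η H c)
        = ε * ((logTent η H (u + (x - b)) - logTent η H u) + (logTent η H u - logTent η H c)) := by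
      unfold bumpDensity
      rw [show x - (b - u) = u + (x - b) by ring]; ring
    rw [e4, Real.norm_eq_abs, abs_mul, abs_of_nonneg hε]
    gcongr
    exact (abs_add_le _ _).trans (by linarith)
  · rw [intervalIntegral.integral_const_mul, intervalIntegral.integral_add (by simp) hint,
      intervalIntegral.integral_const, smul_eq_mul, mul_one]
    have := integral_log_sub_log_le ha hac
    nlinarith

end bumpDensity

/-! ### Measures with a continuous density. -/

/-- The measure on `[0, 1)` with density `w`. -/
noncomputable def densityMeasure (w : ℝ → ℝ) : Measure ℝ :=
  (volume.restrict (Ico 0 1)).withDensity fun y => ENNReal.ofReal (w y)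

lemma densityMeasure_Ico {w : ℝ → ℝ} (hw : Continuous w) (h0 : ∀ y, 0 ≤ w y) {a b : ℝ}
    (hab : a ≤ b) (hs : Ico a b ⊆ Ico 0 1) :
    densityMeasure w (Ico a b) = ENNReal.ofReal (∫ y in a..b, w y) := by
  rw [densityMeasure, withDensity_apply _ measurableSet_Ico,
    Measure.restrict_restrict measurableSet_Ico, inter_eq_left.2 hs,
    intervalIntegral.integral_of_le hab, ← integral_Ico_eq_integral_Ioc,
    ofReal_integral_eq_lintegral_ofReal _ (.of_forall h0)]
  exact ((intervalIntegrable_iff_integrableOn_Ico_of_le hab).1 (hw.intervalIntegrable _ _))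

lemma densityMeasure_compl (w : ℝ → ℝ) : densityMeasure w (Ico 0 1)ᶜ = 0 := by
  rw [densityMeasure, withDensity_apply _ measurableSet_Ico.compl,
    Measure.restrict_restrict measurableSet_Ico.compl]
  simp

lemma isNAdicDoublingWith_densityMeasure {w : ℝ → ℝ} (hw : Continuous w) (h0 : ∀ y, 0 ≤ w y)
    {n : ℕ} (hn : 2 ≤ n) {C : ℝ} (hC : 0 ≤ C)
    (h : ∀ m k : ℤ, ∀ i ∈ Icc 1 n, ∀ j ∈ Icc 1 n,
      ∫ y in (((k : ℝ) - 1) / (n : ℝ) ^ m + ((i : ℝ) - 1) / (n : ℝ) ^ (m + 1))..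
        (((k : ℝ) - 1) / (n : ℝ) ^ m + (i : ℝ) / (n : ℝ) ^ (m + 1)), w y ≤
      C * ∫ y in (((k : ℝ) - 1) / (n : ℝ) ^ m + ((j : ℝ) - 1) / (n : ℝ) ^ (m + 1))..
        (((k : ℝ) - 1) / (n : ℝ) ^ m + (j : ℝ) / (n : ℝ) ^ (m + 1)), w y) :
    IsNAdicDoublingWith (Ico 0 1) n C (densityMeasure w) := by
  rintro _ _ ⟨m, k, i, hi, j, hj, rfl, rfl⟩ h1 h2
  have hle : ∀ i : ℕ, ((k : ℝ) - 1) / (n : ℝ) ^ m + ((i : ℝ) - 1) / (n : ℝ) ^ (m + 1) ≤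
      ((k : ℝ) - 1) / (n : ℝ) ^ m + (i : ℝ) / (n : ℝ) ^ (m + 1) := fun i => by
    gcongr
    linarith
  unfold nAdicChild at *
  rw [densityMeasure_Ico hw h0 (hle i) h1, densityMeasure_Ico hw h0 (hle j) h2,
    ← ENNReal.ofReal_mul hC]
  exact ENNReal.ofReal_le_ofReal (h m k i hi j hj)

lemma nAdicChild_length {n : ℕ} (m k : ℤ) (j : ℕ) :
    ((k : ℝ) - 1) / (n : ℝ) ^ m + (j : ℝ) / (n : ℝ) ^ (m + 1) -
      (((k : ℝ) - 1) / (n : ℝ) ^ m + ((j : ℝ) - 1) / (n : ℝ) ^ (m + 1)) =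
      ((n : ℝ) ^ (m + 1))⁻¹ := by
  ring

/-- Siblings have equal length, so only the range of the density matters. This handles the large n,
without arithmetic. -/
lemma IsNAdicDoublingWith.of_density_bounds {w : ℝ → ℝ} (hw : Continuous w)
    (h1 : ∀ y, 1 ≤ w y) {n : ℕ} (hn : 2 ≤ n) {C : ℝ} (hC : ∀ y, w y ≤ C) :
    IsNAdicDoublingWith (Ico 0 1) n C (densityMeasure w) := by
  have hC0 : 0 ≤ C := zero_le_one.trans ((h1 0).trans (hC 0))
  refine isNAdicDoublingWith_densityMeasure hw (fun y => zero_le_one.trans (h1 y)) hn hC0 fun m k i _ j _ => ?_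
  have hi := nAdicChild_length (n := n) m k i
  have hj := nAdicChild_length (n := n) m k j
  have hL : 0 ≤ ((n : ℝ) ^ (m + 1))⁻¹ := by positivity
  have hub := intervalIntegral.integral_mono_on (sub_nonneg.1 (hi.symm ▸ hL))
    (hw.intervalIntegrable _ _) (_root_.intervalIntegrable_const (μ := volume) (c := C)) fun y _ => hC y
  have hlb := intervalIntegral.integral_mono_on (sub_nonneg.1 (hj.symm ▸ hL))
    (_root_.intervalIntegrable_const (μ := volume) (c := (1 : ℝ))) (hw.intervalIntegrable _ _) fun y _ => h1 y
  rw [intervalIntegral.integral_const, smul_eq_mul] at hub hlb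
  rw [hi] at hub
  rw [hj] at hlb
  refine hub.trans ?_
  rw [mul_comm]
  gcongr
  linarith

/-! ### The n-adic doubling constant of one bump. -/

section siblings

variable {ε η H x T : ℝ}

lemma bumpDensity_eq_one_of_ge {y : ℝ} (hy : x - η ≤ y) : bumpDensity ε η H x y = 1 := by
  rw [bumpDensity, logTent_of_le (by linarith)]; ring

lemma bumpDensity_eq_one_of_le {y : ℝ} (hH : 0 < H) (hy : y ≤ x - H) :
    bumpDensity ε η H x y = 1 := by
  rw [bumpDensity, logTent_of_ge hH (by linarith)]; ring

lemma integral_bumpDensity_le (hη : 0 < η) (hH : 0 < H) (hT : 0 ≤ T)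
    (hw : ∀ y, bumpDensity ε η H x y ≤ 1 + T) {a b : ℝ} (hab : a ≤ b) :
    ∫ y in a..b, bumpDensity ε η H x y ≤ (b - a) + T * H := by
  have hcont := continuous_bumpDensity (ε := ε) (H := H) (x := x) hη
  have hi : IntervalIntegrable ((Ioc (x - H) x).indicator fun _ => T) volume a b := by
    rw [intervalIntegrable_iff_integrableOn_Ioc_of_le hab]
    exact (integrableOn_const (by simp)).indicator measurableSet_Ioc
  have h1 : ∫ y in a..b, bumpDensity ε η H x y ≤
      ∫ y in a..b, (1 + (Ioc (x - H) x).indicator (fun _ => T) y) := by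
    refine intervalIntegral.integral_mono_on hab (hcont.intervalIntegrable _ _)
      (IntervalIntegrable.add (by simp) hi) fun y _ => ?_
    by_cases hy : y ∈ Ioc (x - H) x
    · simpa [indicator_of_mem hy] using hw y
    · rw [indicator_of_notMem hy, add_zero]
      rcases not_and_or.1 hy with h | h
      · exact (bumpDensity_eq_one_of_le hH (not_lt.1 h)).le
      · exact (bumpDensity_eq_one_of_ge (by linarith [not_le.1 h])).le
  refine h1.trans ?_
  rw [intervalIntegral.integral_add (by simp) hi, intervalIntegral.integral_const, smul_eq_mul,
    mul_one]
  gcongr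
  rw [intervalIntegral.integral_of_le hab, setIntegral_indicator measurableSet_Ioc,
    setIntegral_const, smul_eq_mul, mul_comm]
  gcongr
  calc volume.real (Ioc a b ∩ Ioc (x - H) x) ≤ volume.real (Ioc (x - H) x) :=
        measureReal_mono inter_subset_right (by simp)
    _ = H := by rw [Real.volume_real_Ioc_of_le (by linarith)]; ring

lemma le_integral_bumpDensity (hε : 0 ≤ ε) (hη : 0 < η) {a b : ℝ} (hab : a ≤ b) :
    b - a ≤ ∫ y in a..b, bumpDensity ε η H x y := by
  have := intervalIntegral.integral_mono_on hab (_root_.intervalIntegrable_const (μ := volume) (c := (1 : ℝ)))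
    ((continuous_bumpDensity (ε := ε) (H := H) (x := x) hη).intervalIntegrable _ _)
    fun y _ => one_le_bumpDensity hε y
  simpa using this

lemma nAdicChild_left_eq {n : ℕ} (hn : n ≠ 0) {m p : ℤ} (k : ℤ) (j : ℕ) (t : ℝ) :
    ((k : ℝ) - 1) / (n : ℝ) ^ m + ((j : ℝ) - t) / (n : ℝ) ^ (m + 1) =
      ((n : ℝ) ^ p)⁻¹ - (((n : ℝ) ^ (m - p) - k) * n + (n - j + t)) * ((n : ℝ) ^ (m + 1))⁻¹ := by
  have hn0 : (n : ℝ) ≠ 0 := by exact_mod_cast hn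
  rw [zpow_sub₀ hn0, zpow_add_one₀ hn0]
  field_simp
  ring

/-- If some power of `1 / n` is close to `x`, then the bump density is `n`-adic doubling with
a constant close to `1`. -/
lemma isNAdicDoublingWith_bumpDensity (hε : 0 ≤ ε) (hη : 0 < η) (hH : 0 < H) (hT : 0 ≤ T)
    (hw : ∀ y, bumpDensity ε η H x y ≤ 1 + T) {n : ℕ} (hn : 2 ≤ n) {p : ℤ}
    (hp : |((n : ℝ) ^ p)⁻¹ - x| ≤ η) {C : ℝ} (hC : 1 ≤ C)
    (hCH : T * H ≤ (C - 1) * ((n : ℝ) ^ p)⁻¹) (hCε : ε * (4 + Real.log n) ≤ C - 1) :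
    IsNAdicDoublingWith (Ico 0 1) n C (densityMeasure (bumpDensity ε η H x)) := by
  refine isNAdicDoublingWith_densityMeasure (continuous_bumpDensity hη)
    (fun y => zero_le_one.trans (one_le_bumpDensity hε y)) hn (by linarith)
    fun m k i hi j hj => ?_
  have hn1 : (1 : ℝ) < n := by exact_mod_cast hn
  have hn0 : (0 : ℝ) < n := by linarith
  have hL : 0 < ((n : ℝ) ^ (m + 1))⁻¹ := by positivity
  have hilen := nAdicChild_length (n := n) m k i
  have hjlen := nAdicChild_length (n := n) m k j
  have hjlb := le_integral_bumpDensity (H := H) (x := x) hε hη (sub_nonneg.1 (hjlen.symm ▸ hL.le))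
  rw [hjlen] at hjlb
  -- Since the density is at least 1, an additive excess of C - 1 times the length is affordable.
  suffices hmain : ∫ y in (((k : ℝ) - 1) / (n : ℝ) ^ m + ((i : ℝ) - 1) / (n : ℝ) ^ (m + 1))..
        (((k : ℝ) - 1) / (n : ℝ) ^ m + (i : ℝ) / (n : ℝ) ^ (m + 1)), bumpDensity ε η H x y ≤
      (∫ y in (((k : ℝ) - 1) / (n : ℝ) ^ m + ((j : ℝ) - 1) / (n : ℝ) ^ (m + 1))..
        (((k : ℝ) - 1) / (n : ℝ) ^ m + (j : ℝ) / (n : ℝ) ^ (m + 1)), bumpDensity ε η H x y) +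
        (C - 1) * ((n : ℝ) ^ (m + 1))⁻¹ by
    nlinarith [mul_le_mul_of_nonneg_left hjlb (sub_nonneg.2 hC)]
  rcases lt_or_ge m p with hmp | hmp
  · have hiub := integral_bumpDensity_le hη hH hT hw (sub_nonneg.1 (hilen.symm ▸ hL.le))
    have hle : ((n : ℝ) ^ p)⁻¹ ≤ ((n : ℝ) ^ (m + 1))⁻¹ := by
      gcongr
      · exact hn1.le
      · omega
    rw [hilen] at hiub
    have := mul_le_mul_of_nonneg_left hle (sub_nonneg.2 hC)
    linarith
  · obtain ⟨s, hs⟩ := Int.eq_ofNat_of_zero_le (sub_nonneg.2 hmp)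
    have hB : (n : ℝ) ^ (m - p) = ((n ^ s : ℕ) : ℤ) := by rw [hs]; simp
    set B : ℤ := ((n ^ s : ℕ) : ℤ)
    set L : ℝ := ((n : ℝ) ^ (m + 1))⁻¹
    have hleft : ∀ i : ℕ, ((k : ℝ) - 1) / (n : ℝ) ^ m + ((i : ℝ) - 1) / (n : ℝ) ^ (m + 1) =
        ((n : ℝ) ^ p)⁻¹ - ((B - k) * n + (n - i + 1)) * L := fun i => by
      rw [nAdicChild_left_eq (by omega) (p := p), hB]
    have hright : ∀ i : ℕ, ((k : ℝ) - 1) / (n : ℝ) ^ m + (i : ℝ) / (n : ℝ) ^ (m + 1) =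
        ((n : ℝ) ^ p)⁻¹ - ((B - k) * n + (n - i)) * L := fun i => by
      have := nAdicChild_left_eq (n := n) (by omega) (m := m) (p := p) k i 0
      rwa [sub_zero, add_zero, hB] at this
    have hi1 : (1 : ℝ) ≤ i := by exact_mod_cast hi.1
    have hin : (i : ℝ) ≤ n := by exact_mod_cast hi.2
    have hj1 : (1 : ℝ) ≤ j := by exact_mod_cast hj.1
    have hjn : (j : ℝ) ≤ n := by exact_mod_cast hj.2
    -- Here n⁻ᵖ = B / n ^ m is an endpoint of the generation of the parent, which therefore lies on
    -- one side of it. On the right the density is 1.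
    rcases lt_or_ge B k with hk | hk
    · have hk' : (B : ℝ) + 1 ≤ k := by exact_mod_cast hk
      have hone : ∀ y ∈ uIcc (((k : ℝ) - 1) / (n : ℝ) ^ m + ((i : ℝ) - 1) / (n : ℝ) ^ (m + 1))
          (((k : ℝ) - 1) / (n : ℝ) ^ m + (i : ℝ) / (n : ℝ) ^ (m + 1)),
          bumpDensity ε η H x y = 1 := fun y hy => by
        rw [uIcc_of_le (sub_nonneg.1 (hilen.symm ▸ hL.le)), hleft] at hy
        apply bumpDensity_eq_one_of_ge
        have hneg : (B - k) * n + (n - i + 1) ≤ (0 : ℝ) := by nlinarith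
        have := mul_nonpos_of_nonpos_of_nonneg hneg hL.le
        linarith [hy.1, (abs_le.1 hp).1]
      rw [intervalIntegral.integral_congr hone, intervalIntegral.integral_const, smul_eq_mul,
        mul_one, hilen]
      have := mul_nonneg (sub_nonneg.2 hC) hL.le
      linarith
    · have hk' : (0 : ℝ) ≤ B - k := sub_nonneg.2 (by exact_mod_cast hk)
      have hBn : 0 ≤ (B - k) * (n : ℝ) := by positivity
      have mean : ∀ i : ℕ, (i : ℝ) ≤ n →
          |(∫ y in (((k : ℝ) - 1) / (n : ℝ) ^ m + ((i : ℝ) - 1) / (n : ℝ) ^ (m + 1))..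
            (((k : ℝ) - 1) / (n : ℝ) ^ m + (i : ℝ) / (n : ℝ) ^ (m + 1)), bumpDensity ε η H x y)
            - L * (1 + ε * logTent η H (((B - k) * n + (n - i + 1)) * L))| ≤ 2 * ε * L := by
        intro i hin
        have hsub : ((B - k) * n + (n - i + 1)) * L - ((B - k) * n + (n - i)) * L = L := by ring
        have := abs_integral_bumpDensity_sub_le (H := H) (x := x) (b := ((n : ℝ) ^ p)⁻¹)
          (a := ((B - k) * n + (n - i)) * L) (c := ((B - k) * n + (n - i + 1)) * L) hε hη
          (mul_nonneg (by linarith) hL.le) (by linarith) hp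
        rwa [hsub, ← hleft, ← hright] at this
      have ratio : ∀ i j : ℝ, i ≤ n → 1 ≤ i → j ≤ n → 1 ≤ j →
          ((B - k) * n + (n - i + 1)) * L ≤ n * (((B - k) * n + (n - j + 1)) * L) := by
        intro i j hin hi1 hjn hj1
        rw [← mul_assoc]
        gcongr
        nlinarith [mul_nonneg hBn (sub_nonneg.2 hn1.le)]
      -- The tent contributes log n and each of the two means an error 2ε, whence 4 + log n in
      -- `hCε`.
      have hlog := abs_logTent_sub_le_of_ratio (H := H) hη hn1.le (ratio i j hin hi1 hjn hj1)
        (ratio j i hjn hj1 hin hi1)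
      have mi := (abs_le.1 (mean i hin)).2
      have mj := (abs_le.1 (mean j hjn)).1
      have hl := mul_le_mul_of_nonneg_left (mul_le_mul_of_nonneg_left (abs_le.1 hlog).2 hε) hL.le
      have hc := mul_le_mul_of_nonneg_right hCε hL.le
      linarith

end siblings

/-! ### Stability under positive combinations. -/

section algebra

variable {S : Set ℝ} {n : ℕ} {C : ℝ} {μ ν : Measure ℝ}

lemma IsNAdicDoublingWith.mono {C' : ℝ} (h : IsNAdicDoublingWith S n C μ) (hC : C ≤ C') :
    IsNAdicDoublingWith S n C' μ := fun J₁ J₂ hJ h1 h2 =>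
  (h J₁ J₂ hJ h1 h2).trans (mul_le_mul_left (ENNReal.ofReal_le_ofReal hC) _)

lemma IsNAdicDoublingWith.add (hμ : IsNAdicDoublingWith S n C μ)
    (hν : IsNAdicDoublingWith S n C ν) : IsNAdicDoublingWith S n C (μ + ν) :=
  fun J₁ J₂ hJ h1 h2 => by
    rw [Measure.add_apply, Measure.add_apply, mul_add]
    exact add_le_add (hμ J₁ J₂ hJ h1 h2) (hν J₁ J₂ hJ h1 h2)

lemma IsNAdicDoublingWith.smul (hμ : IsNAdicDoublingWith S n C μ) (c : ENNReal) :
    IsNAdicDoublingWith S n C (c • μ) := fun J₁ J₂ hJ h1 h2 => by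
  rw [Measure.smul_apply, Measure.smul_apply, smul_eq_mul, smul_eq_mul, mul_left_comm]
  exact mul_le_mul_right (hμ J₁ J₂ hJ h1 h2) c

lemma IsNAdicDoublingWith.sum {ι : Type*} {μ : ι → Measure ℝ}
    (h : ∀ i, IsNAdicDoublingWith S n C (μ i)) : IsNAdicDoublingWith S n C (Measure.sum μ) := by
  rintro _ _ ⟨m, k, i, hi, j, hj, rfl, rfl⟩ h1 h2
  have hmeas : ∀ i, MeasurableSet (nAdicChild n m k i) := fun _ => measurableSet_Ico
  rw [Measure.sum_apply _ (hmeas i), Measure.sum_apply _ (hmeas j),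
    ← ENNReal.tsum_mul_left]
  exact ENNReal.tsum_le_tsum fun l => h l _ _ ⟨m, k, i, hi, j, hj, rfl, rfl⟩ h1 h2

end algebra

/-! ### Choice of the parameters of a bump. -/

open Filter in
/-- There are arbitrarily small bump densities with prescribed height that are `n`-adic doubling
with a constant close to `1` for finitely many prescribed `n`. -/
lemma frequently_exists_bump {C T : ℝ} (hC : 1 < C) (hT : 0 < T) (N : ℕ) :
    ∃ᶠ q : ℕ in atTop, ∃ (w : ℝ → ℝ) (D : ℝ), Continuous w ∧ (∀ y, 1 ≤ w y) ∧
      (∀ y, w y ≤ 1 + T) ∧ (∀ y, y ≤ ((4 : ℝ) ^ q)⁻¹ / 2 ∨ ((4 : ℝ) ^ q)⁻¹ ≤ y → w y = 1) ∧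
      0 < D ∧ D ≤ ((4 : ℝ) ^ q)⁻¹ / 2 ∧
      T / 2 * D ≤ ∫ y in (((4 : ℝ) ^ q)⁻¹ - D)..((4 : ℝ) ^ q)⁻¹, w y ∧
      ∫ y in (0 : ℝ)..1, w y ≤ 2 ∧
      ∀ n : ℕ, 2 ≤ n → n < N → IsNAdicDoublingWith (Ico 0 1) n C (densityMeasure w) := by
  have hlogN := Real.log_natCast_nonneg N
  have hC1 : 0 < C - 1 := sub_pos.2 hC
  obtain ⟨ε, hε, hε1, hεC⟩ : ∃ ε : ℝ, 0 < ε ∧ ε ≤ 1 ∧ ε * (4 + Real.log N) ≤ C - 1 := by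
    refine ⟨min 1 ((C - 1) / (4 + Real.log N)), by positivity, min_le_left _ _, ?_⟩
    rw [← le_div_iff₀ (by positivity)]
    exact min_le_right _ _
  obtain ⟨ρ, hρ, hρ2, hρT, hρC⟩ : ∃ ρ : ℝ, 0 < ρ ∧ ρ ≤ 1 / 2 ∧ T * ρ ≤ 1 ∧
      T * ρ ≤ (C - 1) / 2 := by
    refine ⟨min (1 / 2) (min (1 / T) ((C - 1) / 2 / T)), by positivity, min_le_left _ _, ?_, ?_⟩
    · rw [mul_comm, ← le_div_iff₀ hT]
      exact (min_le_right _ _).trans (min_le_left _ _)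
    · rw [mul_comm, ← le_div_iff₀ hT]
      exact (min_le_right _ _).trans (min_le_right _ _)
  -- With slope 1 in log scale, the tent needs a factor E in distance to reach height T / ε: it
  -- starts at H, peaks at D = H E and vanishes again at η = H E².
  set E : ℝ := Real.exp (-(T / ε)) with hE
  have hE0 : 0 < E := Real.exp_pos _
  have hE1 : E ≤ 1 := Real.exp_le_one_iff.2 (by have := div_pos hT hε; linarith)
  have hEE : E * E ≤ 1 := mul_le_one₀ hE1 hE0.le hE1
  have hlogE : Real.log E = -(T / ε) := Real.log_exp _
  have hδ : 0 < ρ * (E * E) := by positivity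
  have hδ2 : ρ * (E * E) ≤ 1 / 2 := (mul_le_of_le_one_right hρ.le hEE).trans hρ2
  refine (frequently_exists_zpow_near N hδ (by linarith)).mono fun q hq => ?_
  set x : ℝ := ((4 : ℝ) ^ q)⁻¹
  have hx : 0 < x := by positivity
  have hx1 : x ≤ 1 := inv_le_one_of_one_le₀ (one_le_pow₀ (by norm_num))
  set H : ℝ := ρ * x with hHdef
  have hH : 0 < H := by positivity
  have hHx : H ≤ x / 2 := by nlinarith
  set η : ℝ := ρ * (E * E) * x with hηdef
  have hη : 0 < η := by positivity
  have hηeq : η = H * E * E := by rw [hηdef, hHdef]; ring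
  have hlogη : Real.log η = Real.log H - 2 * (T / ε) := by
    rw [hηeq, Real.log_mul (by positivity) (by positivity),
      Real.log_mul (by positivity) (by positivity), hlogE]; ring
  have hηD : η ≤ H * E := by rw [hηeq]; exact mul_le_of_le_one_right (by positivity) hE1
  have hDH : H * E ≤ H := mul_le_of_le_one_right hH.le hE1
  have hcont := continuous_bumpDensity (ε := ε) (H := H) (x := x) hη
  have hub : ∀ y, bumpDensity ε η H x y ≤ 1 + T := fun y => by
    have h1 := mul_le_mul_of_nonneg_left (logTent_le hη (hηD.trans hDH) (x - y)) hε.le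
    have h2 : ε * ((Real.log H - Real.log η) / 2) = T := by rw [hlogη]; field_simp; ring
    rw [h2] at h1
    exact add_le_add_right h1 1
  have hTH : T * H ≤ 1 := by
    have := mul_le_mul hρT hx1 hx.le zero_le_one
    linarith [mul_assoc T ρ x]
  refine ⟨bumpDensity ε η H x, H * E, hcont, one_le_bumpDensity hε.le, hub, ?_, by positivity,
    hDH.trans hHx, ?_, ?_, ?_⟩
  · rintro y (hy | hy)
    · exact bumpDensity_eq_one_of_le hH (by linarith)
    · exact bumpDensity_eq_one_of_ge (by linarith)
  · set D : ℝ := H * E with hDdef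
    have hD : 0 < D := by positivity
    have hpeak : logTent η H D = T / ε := by
      have : Real.log D = Real.log H - T / ε := by
        rw [hDdef, Real.log_mul (by positivity) (by positivity), hlogE]; ring
      have hTε := div_pos hT hε
      rw [logTent, max_eq_left hηD, this, hlogη]
      ring_nf
      rw [min_self, max_eq_right (by positivity)]
    -- Within a factor 2 of the peak the density drops by at most ε log 2 ≤ 1, which the constant
    -- term 1 makes up for.
    have hlow : ∀ y ∈ Icc (x - D) (x - D / 2), T ≤ bumpDensity ε η H x y := fun y hy => by
      have h1 := (abs_le.1 (abs_logTent_sub_le_of_ratio (H := H) hη one_le_two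
        (c := x - y) (d := D) (by linarith [hy.1]) (by linarith [hy.2]))).1
      rw [hpeak] at h1
      have h2 := mul_le_mul_of_nonneg_left h1 hε.le
      have h3 : ε * Real.log 2 ≤ 1 :=
        mul_le_one₀ hε1 (Real.log_nonneg one_le_two) (by linarith [Real.log_two_lt_d9])
      have h4 : ε * (T / ε) = T := by field_simp
      unfold bumpDensity
      linarith
    have hi := fun a b : ℝ => hcont.intervalIntegrable (μ := volume) a b
    have h1 := intervalIntegral.integral_mono_on (by linarith : x - D ≤ x - D / 2)
      (_root_.intervalIntegrable_const (μ := volume) (c := T)) (hi _ _) hlow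
    have h2 := le_integral_bumpDensity (H := H) (x := x) hε.le hη (by linarith : x - D / 2 ≤ x)
    rw [← intervalIntegral.integral_add_adjacent_intervals (hi (x - D) (x - D / 2)) (hi _ x)]
    rw [intervalIntegral.integral_const, smul_eq_mul] at h1
    linarith
  · have := integral_bumpDensity_le hη hH hT.le hub zero_le_one
    linarith
  · intro n hn hnN
    obtain ⟨p, hp⟩ := hq n hn hnN
    refine isNAdicDoublingWith_bumpDensity hε.le hη hH hT.le hub hn hp hC.le ?_ ?_
    · have h1 : x / 2 ≤ ((n : ℝ) ^ p)⁻¹ := by nlinarith [(abs_le.1 hp).1]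
      have h2 := mul_le_mul_of_nonneg_right hρC hx.le
      nlinarith [mul_le_mul_of_nonneg_left h1 hC1.le]
    · refine le_trans ?_ hεC
      gcongr

/-! ### From one measure to infinitely many. -/

section mixtures

variable {μ : Measure ℝ}

lemma densityMeasure_const_one_Ico {a b : ℝ} (hab : a ≤ b) (hs : Ico a b ⊆ Ico 0 1) :
    densityMeasure (fun _ => 1) (Ico a b) = ENNReal.ofReal (b - a) := by
  rw [densityMeasure_Ico continuous_const (fun _ => zero_le_one) hab hs]
  simp

/-- A single probability measure whose ratios on certain adjacent intervals blow up yields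
infinitely many, by mixing with Lebesgue measure. -/
lemma infinite_setOf_isNAdicDoublingWith {f : ℕ → ℝ} (hf : ∀ n, 2 ≤ n → 1 < f n)
    (hprob : IsProbabilityMeasure μ) (hsupp : μ (Ico 0 1)ᶜ = 0)
    (hdoub : ∀ n : ℕ, 2 ≤ n → IsNAdicDoublingWith (Ico 0 1) n (f n) μ)
    {a : ℝ} (ha : 0 < a) {x D : ℕ → ℝ} (hD : ∀ k, 0 < D k) (hxD : ∀ k, 0 ≤ x k - D k)
    (hxD1 : ∀ k, x k + D k ≤ 1)
    (hleft : ∀ k, ENNReal.ofReal (a * 2 ^ k * D k) ≤ μ (Ico (x k - D k) (x k)))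
    (hright : ∀ k, μ (Ico (x k) (x k + D k)) ≤ ENNReal.ofReal (2 * D k)) :
    {μ : Measure ℝ | IsProbabilityMeasure μ ∧ μ (Ico 0 1)ᶜ = 0 ∧
      (∀ n : ℕ, 2 ≤ n → IsNAdicDoublingWith (Ico 0 1) n (f n) μ) ∧
      ¬ IsDoublingOn (Ico 0 1) μ}.Infinite := by
  set lam : Measure ℝ := densityMeasure fun _ => 1
  have hlamsupp : lam (Ico 0 1)ᶜ = 0 := densityMeasure_compl _
  have hlamprob : lam univ = 1 := by
    rw [← measure_add_measure_compl (measurableSet_Ico (a := (0 : ℝ)) (b := 1)), hlamsupp,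
      densityMeasure_const_one_Ico zero_le_one subset_rfl]
    simp
  have hsubl : ∀ k, Ico (x k - D k) (x k) ⊆ Ico 0 1 := fun k =>
    Ico_subset_Ico (hxD k) (by linarith [hxD1 k, hD k])
  have hsubr : ∀ k, Ico (x k) (x k + D k) ⊆ Ico 0 1 := fun k =>
    Ico_subset_Ico (by linarith [hxD k, hD k]) (hxD1 k)
  have hlaml : ∀ k, lam (Ico (x k - D k) (x k)) = ENNReal.ofReal (D k) := fun k => by
    rw [densityMeasure_const_one_Ico (by linarith [hD k]) (hsubl k)]
    congr 1; ring
  have hlamr : ∀ k, lam (Ico (x k) (x k + D k)) = ENNReal.ofReal (D k) := fun k => by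
    rw [densityMeasure_const_one_Ico (by linarith [hD k]) (hsubr k)]
    congr 1; ring
  have hinv0 : ∀ s : ℕ, ((s : ENNReal) + 1)⁻¹ ≠ 0 := fun s => by
    simp [ENNReal.add_eq_top]
  have hinvtop : ∀ s : ℕ, ((s : ENNReal) + 1)⁻¹ ≠ ⊤ := fun s => by simp
  refine infinite_of_injective_forall_mem
    (f := fun s : ℕ => ((s : ENNReal) + 1)⁻¹ • (μ + (s : ENNReal) • lam)) ?_ ?_
  · intro s t hst
    -- For this k the measure μ exceeds Lebesgue measure on the left interval, so distinct weights
    -- give distinct mixtures.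
    obtain ⟨k, hk⟩ := pow_unbounded_of_one_lt (1 / a) (one_lt_two (α := ℝ))
    have hk1 : 1 < a * 2 ^ k := by rwa [div_lt_iff₀' ha] at hk
    have h := congrArg (fun ν : Measure ℝ => (ν (Ico (x k - D k) (x k))).toReal) hst
    simp only [Measure.smul_apply, Measure.add_apply, smul_eq_mul, hlaml] at h
    have hfin : ∀ s : ℕ, (s : ENNReal) * ENNReal.ofReal (D k) ≠ ⊤ := fun s =>
      ENNReal.mul_ne_top (by simp) ENNReal.ofReal_ne_top
    have htop : ∀ s : ℕ, (s : ENNReal) ≠ ⊤ := fun s => by simp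
    rw [ENNReal.toReal_mul, ENNReal.toReal_mul, ENNReal.toReal_add (measure_ne_top _ _) (hfin s),
      ENNReal.toReal_add (measure_ne_top _ _) (hfin t), ENNReal.toReal_inv, ENNReal.toReal_inv,
      ENNReal.toReal_add (htop s) (by simp), ENNReal.toReal_add (htop t) (by simp),
      ENNReal.toReal_mul, ENNReal.toReal_mul, ENNReal.toReal_ofReal (hD k).le] at h
    simp only [ENNReal.toReal_natCast, ENNReal.toReal_one] at h
    have hp : D k < (μ (Ico (x k - D k) (x k))).toReal :=
      (lt_mul_of_one_lt_left (hD k) hk1).trans_le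
        ((ENNReal.ofReal_le_iff_le_toReal (measure_ne_top _ _)).1 (hleft k))
    set P := (μ (Ico (x k - D k) (x k))).toReal
    have hs : (0 : ℝ) < s + 1 := by positivity
    have ht : (0 : ℝ) < t + 1 := by positivity
    field_simp at h
    have h0 : ((t : ℝ) - s) * (P - D k) = 0 := by linarith
    rcases mul_eq_zero.1 h0 with h0 | h0
    · exact_mod_cast (sub_eq_zero.1 h0).symm
    · linarith
  · intro s
    refine ⟨⟨?_⟩, ?_, fun n hn => ?_, ?_⟩
    · rw [Measure.smul_apply, Measure.add_apply, Measure.smul_apply, hlamprob, measure_univ,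
        smul_eq_mul, smul_eq_mul, mul_one, add_comm]
      exact ENNReal.inv_mul_cancel (by simp) (by simp)
    · simp [hsupp, hlamsupp]
    · refine ((hdoub n hn).add (IsNAdicDoublingWith.smul ?_ _)).smul _
      exact (IsNAdicDoublingWith.of_density_bounds continuous_const (fun _ => le_rfl) hn
        fun _ => le_rfl).mono (hf n hn).le
    · rintro ⟨C, hC, h⟩
      obtain ⟨k, hk⟩ := pow_unbounded_of_one_lt (C * (2 + s) / a) (one_lt_two (α := ℝ))
      have h1 := (h (x k - D k) (D k) (hD k)
        (by rw [sub_add_cancel]; exact hsubl k)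
        (by rw [sub_add_cancel, show x k - D k + 2 * D k = x k + D k by ring]; exact hsubr k)).1
      rw [sub_add_cancel, show x k - D k + 2 * D k = x k + D k by ring, Measure.smul_apply,
        Measure.smul_apply, smul_eq_mul, smul_eq_mul, mul_left_comm,
        ENNReal.mul_le_mul_iff_right (hinv0 s) (hinvtop s), Measure.add_apply, Measure.add_apply,
        Measure.smul_apply, Measure.smul_apply, smul_eq_mul, smul_eq_mul, hlamr] at h1
      have h2 : ENNReal.ofReal (a * 2 ^ k * D k) ≤ ENNReal.ofReal (C * (2 * D k + s * D k)) := by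
        rw [ENNReal.ofReal_mul hC.le, ENNReal.ofReal_add (by linarith [hD k])
          (mul_nonneg (Nat.cast_nonneg s) (hD k).le), ENNReal.ofReal_mul (Nat.cast_nonneg s),
          ENNReal.ofReal_natCast]
        refine ((hleft k).trans le_self_add).trans (h1.trans ?_)
        gcongr
        exact hright k
      have hnn : 0 ≤ C * (2 * D k + s * D k) := by have := hD k; positivity
      have h3 := (ENNReal.ofReal_le_ofReal_iff hnn).1 h2
      rw [div_lt_iff₀' ha] at hk
      nlinarith [mul_lt_mul_of_pos_right hk (hD k)]

end mixtures

/-! ### Summation of the bumps. -/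

lemma exists_forall_le_of_monotoneOn_of_not_bddAbove {f : ℕ → ℝ}
    (hf_mono : MonotoneOn f (Set.Ici 2)) (hf_unbdd : ¬ BddAbove (f '' Set.Ici 2)) (B : ℝ) :
    ∃ N : ℕ, ∀ n, N ≤ n → B ≤ f n := by
  rw [not_bddAbove_iff] at hf_unbdd
  obtain ⟨_, ⟨N, hN, rfl⟩, hB⟩ := hf_unbdd B
  exact ⟨N, fun n hn => hB.le.trans (hf_mono hN (le_trans (mem_Ici.1 hN) hn) hn)⟩

theorem theorem4p4 (f : ℕ → ℝ) (hf_gt : ∀ n : ℕ, 2 ≤ n → 1 < f n)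
    (hf_mono : MonotoneOn f (Set.Ici 2)) (hf_unbdd : ¬ BddAbove (f '' Set.Ici 2)) :
    {μ : Measure ℝ | IsProbabilityMeasure μ ∧ μ (Set.Ico 0 1)ᶜ = 0 ∧
      (∀ n : ℕ, 2 ≤ n → IsNAdicDoublingWith (Set.Ico 0 1) n (f n) μ) ∧
      ¬ IsDoublingOn (Set.Ico 0 1) μ}.Infinite := by
  choose N hN using fun k : ℕ =>
    exists_forall_le_of_monotoneOn_of_not_bddAbove hf_mono hf_unbdd (1 + 4 ^ k)
  -- The constant f 2 is the least value of f, so it serves every n < N k.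
  obtain ⟨φ, hφ, hbump⟩ := Filter.extraction_forall_of_frequently fun k =>
    (frequently_exists_bump (hf_gt 2 le_rfl) (by positivity : (0 : ℝ) < 4 ^ k) (N k)).and_eventually
      (Filter.eventually_ge_atTop 1)
  choose hw hφ1 using hbump
  choose w D hcont hw1 hwub hwone hD hDx hint hmass hdoub using hw
  set x : ℕ → ℝ := fun k => ((4 : ℝ) ^ φ k)⁻¹ with hxdef
  have hw0 : ∀ k y, 0 ≤ w k y := fun k y => zero_le_one.trans (hw1 k y)
  have hx : ∀ k, 0 < x k := fun k => by positivity
  have hx4 : ∀ k, x k ≤ 1 / 4 := fun k => by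
    rw [hxdef, one_div]
    exact inv_anti₀ (by norm_num) (le_self_pow₀ (by norm_num) (by have := hφ1 k; omega))
  have hxlt : ∀ {j k}, j < k → 4 * x k ≤ x j := fun {j k} hjk => by
    have : (4 : ℝ) ^ (φ j + 1) ≤ 4 ^ φ k := pow_le_pow_right₀ (by norm_num) (hφ hjk)
    have h1 := inv_anti₀ (by positivity) this
    rw [pow_succ, mul_inv] at h1
    simp only [hxdef]
    linarith
  have hDx : ∀ k, D k ≤ x k / 2 := hDx
  have hxD : ∀ k, 0 ≤ x k - D k := fun k => by linarith [hDx k, hx k]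
  have hxD1 : ∀ k, x k + D k ≤ 1 := fun k => by linarith [hDx k, hx4 k]
  have hright : ∀ j k, densityMeasure (w j) (Ico (x k) (x k + D k)) = ENNReal.ofReal (D k) := by
    intro j k
    rw [densityMeasure_Ico (hcont j) (hw0 j) (by linarith [hD k])
      (Ico_subset_Ico (hx k).le (hxD1 k))]
    have hone : ∀ y ∈ uIcc (x k) (x k + D k), w j y = 1 := fun y hy => by
      rw [uIcc_of_le (by linarith [hD k])] at hy
      refine hwone j y ?_
      -- Earlier bumps live above x j / 2 ≥ 2 x k, the others to the left of x k.
      rcases lt_or_ge j k with hjk | hjk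
      · left
        have := hxlt hjk
        change y ≤ x j / 2
        linarith [hy.2, hDx k, hx k]
      · right
        refine le_trans ?_ hy.1
        rcases hjk.eq_or_lt with rfl | hjk
        · exact le_rfl
        · linarith [hxlt hjk, hx j]
    rw [intervalIntegral.integral_congr hone]
    simp
  set c : ℕ → ENNReal := fun k => ENNReal.ofReal ((1 / 2) ^ k)
  have hcsum : ∑' k, c k = ENNReal.ofReal 2 := by
    rw [← ENNReal.ofReal_tsum_of_nonneg (fun k => by positivity) summable_geometric_two,
      tsum_geometric_two]
  set μ₀ : Measure ℝ := Measure.sum fun k => c k • densityMeasure (w k)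
  have hμ₀ : ∀ a b : ℝ, μ₀ (Ico a b) = ∑' k, c k * densityMeasure (w k) (Ico a b) :=
    fun a b => Measure.sum_apply _ measurableSet_Ico
  have hsupp : μ₀ (Ico 0 1)ᶜ = 0 := by
    rw [Measure.sum_apply _ measurableSet_Ico.compl]
    simp [densityMeasure_compl]
  have huniv : μ₀ univ = μ₀ (Ico 0 1) := by
    rw [← measure_add_measure_compl (measurableSet_Ico (a := (0 : ℝ)) (b := 1)), hsupp, add_zero]
  have hM4 : μ₀ univ ≤ ENNReal.ofReal 4 := by
    rw [huniv, hμ₀]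
    calc ∑' k, c k * densityMeasure (w k) (Ico 0 1) ≤ ∑' k, c k * ENNReal.ofReal 2 := by
          refine ENNReal.tsum_le_tsum fun k => ?_
          rw [densityMeasure_Ico (hcont k) (hw0 k) zero_le_one subset_rfl]
          gcongr
          exact hmass k
      _ = ENNReal.ofReal 4 := by
          rw [ENNReal.tsum_mul_right, hcsum, ← ENNReal.ofReal_mul (by norm_num)]
          norm_num
  have hM1 : 1 ≤ μ₀ univ := by
    rw [huniv, hμ₀]
    refine le_trans ?_ (ENNReal.le_tsum 0)
    rw [densityMeasure_Ico (hcont 0) (hw0 0) zero_le_one subset_rfl]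
    have := intervalIntegral.integral_mono_on zero_le_one
      (_root_.intervalIntegrable_const (μ := volume) (c := (1 : ℝ)))
      ((hcont 0).intervalIntegrable 0 1) fun y _ => hw1 0 y
    simpa [c] using this
  have hM0 : μ₀ univ ≠ 0 := (zero_lt_one.trans_le hM1).ne'
  have hMtop : μ₀ univ ≠ ⊤ := (hM4.trans_lt ENNReal.ofReal_lt_top).ne
  -- Weight 2⁻ᵏ times height 4ᵏ leaves 2ᵏ. The factor 1 / 8 combines the 1 / 2 lost in the bump with
  -- the total mass, at most 4.
  refine infinite_setOf_isNAdicDoublingWith (μ := (μ₀ univ)⁻¹ • μ₀) hf_gt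
    ⟨ENNReal.inv_mul_cancel hM0 hMtop⟩ (by simp [hsupp]) (fun n hn => ?_)
    (a := 1 / 8) (by norm_num) hD hxD hxD1 (fun k => ?_) (fun k => ?_)
  · refine (IsNAdicDoublingWith.sum fun k => IsNAdicDoublingWith.smul ?_ _).smul _
    rcases lt_or_ge n (N k) with hnk | hnk
    · exact (hdoub k n hn hnk).mono (hf_mono self_mem_Ici hn hn)
    · exact .of_density_bounds (hcont k) (hw1 k) hn fun y => (hwub k y).trans (hN k n hnk)
  · have h1 : ENNReal.ofReal ((1 / 2) ^ k * (4 ^ k / 2 * D k)) ≤ μ₀ (Ico (x k - D k) (x k)) := by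
      rw [hμ₀]
      refine le_trans ?_ (ENNReal.le_tsum k)
      rw [ENNReal.ofReal_mul (by positivity), densityMeasure_Ico (hcont k) (hw0 k)
        (by linarith [hD k]) (Ico_subset_Ico (hxD k) (by linarith [hx4 k]))]
      gcongr
      exact hint k
    have h2 : (1 / 8 : ℝ) * 2 ^ k * D k = 4⁻¹ * ((1 / 2) ^ k * (4 ^ k / 2 * D k)) := by
      rw [show (4 : ℝ) ^ k = 2 ^ k * 2 ^ k by rw [← mul_pow]; norm_num, one_div_pow]
      field_simp
      ring
    rw [h2, ENNReal.ofReal_mul (by norm_num), Measure.smul_apply, smul_eq_mul]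
    refine mul_le_mul' ?_ h1
    rw [ENNReal.ofReal_inv_of_pos (by norm_num)]
    exact ENNReal.inv_le_inv.2 hM4
  · rw [Measure.smul_apply, smul_eq_mul, hμ₀]
    simp only [hright]
    rw [ENNReal.tsum_mul_right, hcsum, ← ENNReal.ofReal_mul (by norm_num)]
    exact mul_le_of_le_one_left' (ENNReal.inv_le_one.2 hM1)
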